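/- Let $N\ge 2$ be an integer and let $b>0$ and $q$ be real numbers with $1+\frac{2b}{N-1}<q<q^e$, where $q^e:=1+\frac{8+2b}{N-4}$ if $N\ge5$ and $q^e:=\infty$ if $N\le4$. Put $D:=\frac{Nq-N-2b}{4}$. Let $H^2_{rd}$ be the space of complex-valued $v\in H^2(\mathbb{R}^N)$ that are radial, i.e. $v(x)$ depends only on $|x|$ (almost everywhere), let $\|\cdot\|$ denote the norm of $L^2(\mathbb{R}^N)$, and let $\Delta v\in L^2(\mathbb{R}^N)$ be the distributional Laplacian of $v$. Then $|x|^b|v|^{1+q}$ is integrable on $\mathbb{R}^N$ for every $v\in H^2_{rd}$, and there is a sharp (that is, smallest possible) constant $C=C_{N,q,b}>0$ such that, for all $v\in H^2_{rd}$, $$\int_{\mathbb{R}^N}|x|^b|v(x)|^{1+q}\,dx\le C\,\|v\|^{1+q-D}\,\|\Delta v\|^{D}.$$ -/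

import Mathlib

open MeasureTheory TemperedDistribution
open scoped SchwartzMap Laplacian

noncomputable section

/-- The Lebesgue space `L²(ℝᴺ)` of complex-valued functions, with its usual norm. -/
abbrev L2 (N : ℕ) : Type := Lp ℂ 2 (volume : Measure (EuclideanSpace ℝ (Fin N)))

/-- `v` is spherically symmetric: almost everywhere, `v(x)` is a function of `|x|`. -/
def IsRadial {N : ℕ} (v : L2 N) : Prop :=
  ∃ g : ℝ → ℂ, ∀ᵐ x : EuclideanSpace ℝ (Fin N), v x = g ‖x‖

/-- The radial Sobolev space `H²_rd(ℝᴺ)`, as a type of elements of `L²(ℝᴺ)`. -/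
structure H2rd (N : ℕ) where
  /-- the underlying square integrable function -/
  toL2 : L2 N
  memSobolev : MemSobolev 2 2 (toL2 : 𝓢'(EuclideanSpace ℝ (Fin N), ℂ))
  radial : IsRadial toL2

/-- For `v ∈ H²`, the distribution `Δ v` is given by a square integrable function. -/
theorem H2rd.exists_laplacian {N : ℕ} (v : H2rd N) :
    ∃ w : L2 N, Δ (v.toL2 : 𝓢'(EuclideanSpace ℝ (Fin N), ℂ)) =
      (w : 𝓢'(EuclideanSpace ℝ (Fin N), ℂ)) := by
  have h := v.memSobolev.laplacian
  rw [sub_self] at h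
  exact memSobolev_zero_iff.mp h

/-- The (distributional) Laplacian of `v ∈ H²_rd`, as an element of `L²`. -/
def H2rd.laplacian {N : ℕ} (v : H2rd N) : L2 N := v.exists_laplacian.choose

/-- `v.laplacian` represents the distributional Laplacian of `v`. -/
theorem H2rd.laplacian_spec {N : ℕ} (v : H2rd N) :
    Δ (v.toL2 : 𝓢'(EuclideanSpace ℝ (Fin N), ℂ)) =
      (v.laplacian : 𝓢'(EuclideanSpace ℝ (Fin N), ℂ)) :=
  v.exists_laplacian.choose_spec

/-- The energy-critical exponent `q^e`: `1 + (8 + 2b)/(N - 4)` if `N > 4`, and `∞` otherwise. -/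
def energyCriticalExponent (N : ℕ) (b : ℝ) : EReal :=
  if 4 < N then ((1 + (8 + 2 * b) / ((N : ℝ) - 4) : ℝ) : EReal) else ⊤

/-- The exponent `D = (Nq - N - 2b)/4`. -/
def gnExponent (N : ℕ) (b q : ℝ) : ℝ := ((N : ℝ) * q - N - 2 * b) / 4

/-- The density `|x|^b |v(x)|^(1+q)`. -/
def weightedDensity {N : ℕ} (b q : ℝ) (v : H2rd N) (x : EuclideanSpace ℝ (Fin N)) : ℝ :=
  ‖x‖ ^ b * ‖v.toL2 x‖ ^ (1 + q)

end

open Set Filter Topology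
open scoped Convolution ContDiff

/-! Put `N = n + 1`. For a radial function with profile `g`, the Laplacian `h` is controlled through
the flux identity `(r ^ n g')' = r ^ n h`. Scaling the argument and the amplitude reduces everything
to profiles with both weighted `L²` norms at most one; undoing the scaling (`rescale`) produces the
exponents `1 + q - D` and `D`.

For such profiles two pointwise bounds suffice. The flux vanishes at the origin, so Cauchy–Schwarz
gives `‖g' r‖ ≤ r ^ ((1 - n) / 2)`, and integrating from `1` down to `r` gives `‖g r‖ ≲ r ^ (-γ)` on
`(0, 1]` for any `γ > 0` with `γ ≥ (n - 3) / 2`. For `r ≥ 1` the decay is `‖g r‖ ≲ r ^ (-n / 2)`: on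
`[r, r + 1]` the profile is close to a harmonic one, the `L²` bound makes it small at two separated
points, and this controls the flux and hence `g r`. No `L²` bound on the gradient is needed.

Near the origin the integrand is then dominated by an integrable power; this is where `q < q^e`
enters. At infinity the decay of `‖g‖ ^ (q - 1)` absorbs `r ^ b`, by the lower bound on `q`, and the
remaining `‖g‖ ^ 2` is integrable.

A general `v` is mollified by radial kernels. The mollifications are smooth and radial, their
Laplacians are the mollifications of `Δ v`, and neither `L²` norm increases. Fatou's lemma passes
the inequality to the limit. The smallest constant is the infimum of the admissible ones, positive
because some integral is positive. -/

/-- `g` is the profile of a radial function on `ℝⁿ⁺¹`, with radial derivative `g₁` and Laplacian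
`h`, whose weighted `L²` norms are at most `A` and `B`. -/
structure RadialProfile (n : ℕ) (A B : ℝ) (g g₁ h : ℝ → ℂ) : Prop where
  hasDerivAt : ∀ r > 0, HasDerivAt g (g₁ r) r
  hasDerivAt_flux : ∀ r > 0, HasDerivAt (fun s : ℝ => (s ^ n) • g₁ s) ((r ^ n) • h r) r
  continuous_deriv : Continuous g₁
  continuous_laplacian : Continuous h
  integrableOn : IntegrableOn (fun r => r ^ n * ‖g r‖ ^ 2) (Ioi 0)
  integral_le : ∫ r in Ioi 0, r ^ n * ‖g r‖ ^ 2 ≤ A ^ 2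
  integrableOn_laplacian : IntegrableOn (fun r => r ^ n * ‖h r‖ ^ 2) (Ioi 0)
  integral_laplacian_le : ∫ r in Ioi 0, r ^ n * ‖h r‖ ^ 2 ≤ B ^ 2

/-! ### Pointwise bounds for normalized profiles. -/

namespace RadialProfile

variable {n : ℕ} {g g₁ h : ℝ → ℂ}

/-- Cauchy–Schwarz for `∫ s ^ n h`, in the form of Young's inequality with a free weight `t`, which
avoids square roots; `t` is chosen at each use. -/
theorem norm_flux_sub_le (H : RadialProfile n 1 1 g g₁ h) {a r M t : ℝ} (ha : 0 ≤ a)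
    (har : a ≤ r) (hM : (r - a) * r ^ n ≤ M) (ht : 0 < t) :
    ‖(r ^ n) • g₁ r - (a ^ n) • g₁ a‖ ≤ (t * M + 1 / t) / 2 := by
  have hc : Continuous fun s : ℝ => (s ^ n) • h s := by
    have := H.continuous_laplacian
    fun_prop
  have hc1 : Continuous fun s : ℝ => (s ^ n) • g₁ s := by
    have := H.continuous_deriv
    fun_prop
  have hcn : Continuous fun s : ℝ => s ^ n * ‖h s‖ ^ 2 := by
    have := H.continuous_laplacian
    fun_prop
  have key : ∫ s in a..r, (s ^ n) • h s = (r ^ n) • g₁ r - (a ^ n) • g₁ a :=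
    intervalIntegral.integral_eq_sub_of_hasDerivAt_of_le har hc1.continuousOn
      (fun s hs => H.hasDerivAt_flux s (ha.trans_lt hs.1)) (hc.intervalIntegrable _ _)
  rw [← key]
  have h1 : ‖∫ s in a..r, (s ^ n) • h s‖ ≤
      ∫ s in a..r, (t * r ^ n + (1 / t) * (s ^ n * ‖h s‖ ^ 2)) / 2 := by
    refine intervalIntegral.norm_integral_le_of_norm_le har ?_ ?_
    · refine Eventually.of_forall fun s hs => ?_
      have hs0 : 0 ≤ s := ha.trans hs.1.le
      have hsn : s ^ n ≤ r ^ n := pow_le_pow_left₀ hs0 hs.2 n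
      have hs1 : 0 ≤ s ^ n := by positivity
      rw [norm_smul, Real.norm_of_nonneg hs1]
      have e : 0 ≤ s ^ n * (1 / t) * (t - ‖h s‖) ^ 2 := by positivity
      have e2 : s ^ n * (1 / t) * (t - ‖h s‖) ^ 2 =
          t * s ^ n + (1 / t) * (s ^ n * ‖h s‖ ^ 2) - 2 * (s ^ n * ‖h s‖) := by
        field_simp
        ring
      nlinarith [mul_le_mul_of_nonneg_left hsn ht.le]
    · exact Continuous.intervalIntegrable (by fun_prop) _ _
  refine h1.trans ?_
  have h2 : ∫ s in a..r, s ^ n * ‖h s‖ ^ 2 ≤ 1 := by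
    rw [intervalIntegral.integral_of_le har]
    refine (setIntegral_mono_set H.integrableOn_laplacian ?_ ?_).trans
      (H.integral_laplacian_le.trans (by norm_num))
    · filter_upwards [ae_restrict_mem measurableSet_Ioi] with s hs
      have : (0 : ℝ) < s := hs
      simp only [Pi.zero_apply]
      positivity
    · exact (Ioc_subset_Ioi_self.trans (Ioi_subset_Ioi ha)).eventuallyLE
  rw [intervalIntegral.integral_div, intervalIntegral.integral_add
    (by simp) ((hcn.const_mul _).intervalIntegrable _ _), intervalIntegral.integral_const,
    intervalIntegral.integral_const_mul, smul_eq_mul]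
  have h3 : 1 / t * ∫ s in a..r, s ^ n * ‖h s‖ ^ 2 ≤ 1 / t * 1 :=
    mul_le_mul_of_nonneg_left h2 (by positivity)
  nlinarith [mul_le_mul_of_nonneg_left hM ht.le]

theorem norm_deriv_le (H : RadialProfile n 1 1 g g₁ h) (hn : n ≠ 0) {r : ℝ} (hr : 0 < r) :
    ‖g₁ r‖ ≤ r ^ ((1 - n : ℝ) / 2) := by
  have hd : 0 < r ^ (((n : ℝ) + 1) / 2) := Real.rpow_pos_of_pos hr _
  have hsq : r ^ (((n : ℝ) + 1) / 2) * r ^ (((n : ℝ) + 1) / 2) = r * r ^ n := by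
    rw [← Real.rpow_add hr, ← pow_succ', ← Real.rpow_natCast]
    push_cast
    ring_nf
  -- The flux at `0` vanishes because `n ≠ 0`. This `t` balances the two terms of the bound.
  have := H.norm_flux_sub_le (le_refl 0) hr.le (M := r * r ^ n)
    (t := (r ^ (((n : ℝ) + 1) / 2))⁻¹) (by simp) (by positivity)
  rw [zero_pow hn, zero_smul, sub_zero, norm_smul, Real.norm_of_nonneg (by positivity), ← hsq] at this
  have h2 : r ^ n * ‖g₁ r‖ ≤ r ^ (((n : ℝ) + 1) / 2) := by
    refine this.trans (le_of_eq ?_)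
    field_simp
    ring
  have h3 : r ^ ((1 - n : ℝ) / 2) = r ^ (((n : ℝ) + 1) / 2) / r ^ n := by
    rw [← Real.rpow_natCast, ← Real.rpow_sub hr]
    ring_nf
  rw [h3, le_div_iff₀ (by positivity)]
  linarith

/-- Otherwise the weighted `L²` mass on `[a, c]` alone would exceed one. -/
theorem exists_norm_le (H : RadialProfile n 1 1 g g₁ h) {a c d : ℝ} (ha : 0 < a) (hac : a ≤ c)
    (hd : 0 ≤ d) (hdn : 1 < (c - a) * (a ^ n * d ^ 2)) : ∃ s ∈ Icc a c, ‖g s‖ ≤ d := by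
  by_contra! hcon
  have h1 : ∫ s in Ioc a c, a ^ n * d ^ 2 ≤ ∫ s in Ioc a c, s ^ n * ‖g s‖ ^ 2 := by
    refine setIntegral_mono_on (integrableOn_const (by simp)) (H.integrableOn.mono_set ?_) measurableSet_Ioc ?_
    · exact Ioc_subset_Ioi_self.trans (Ioi_subset_Ioi ha.le)
    · intro s hs
      have := (hcon s ⟨hs.1.le, hs.2⟩).le
      have hs1 := hs.1.le
      have hs0 : 0 < s := ha.trans hs.1
      gcongr
  have h2 : ∫ s in Ioc a c, s ^ n * ‖g s‖ ^ 2 ≤ 1 := by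
    refine (setIntegral_mono_set H.integrableOn ?_ ?_).trans
      (H.integral_le.trans (by norm_num))
    · filter_upwards [ae_restrict_mem measurableSet_Ioi] with s hs
      have : (0 : ℝ) < s := hs
      simp only [Pi.zero_apply]
      positivity
    · exact (Ioc_subset_Ioi_self.trans (Ioi_subset_Ioi ha.le)).eventuallyLE
  rw [setIntegral_const, smul_eq_mul, Real.volume_real_Ioc_of_le hac] at h1
  linarith

/-- On `[r, r + 1]` the profile follows the harmonic profile with the same flux at `r`. -/
theorem norm_sub_sub_le (H : RadialProfile n 1 1 g g₁ h) {r d : ℝ} (hr : 1 ≤ r) (hd : 0 < d)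
    (hdr : d ^ 2 * r ^ n = 1) {s₁ s₂ : ℝ} (h₁ : s₁ ∈ Icc r (r + 1)) (h₂ : s₂ ∈ Icc r (r + 1))
    (h₁₂ : s₁ ≤ s₂) :
    ‖g s₂ - g s₁ - (∫ t in s₁..s₂, (t ^ n)⁻¹ : ℝ) • ((r ^ n) • g₁ r)‖ ≤ 2 ^ n * d := by
  have hr0 : 0 < r := by linarith
  have hpos : ∀ t ∈ uIcc s₁ s₂, 0 < t := fun t ht => by
    rw [uIcc_of_le h₁₂] at ht
    linarith [ht.1, h₁.1]
  have hci : ContinuousOn (fun t : ℝ => (t ^ n)⁻¹) (uIcc s₁ s₂) :=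
    ContinuousOn.inv₀ (by fun_prop) fun t ht => (pow_pos (hpos t ht) n).ne'
  have e1 : g s₂ - g s₁ = ∫ t in s₁..s₂, g₁ t :=
    (intervalIntegral.integral_eq_sub_of_hasDerivAt (fun t ht => H.hasDerivAt t (hpos t ht))
      (H.continuous_deriv.intervalIntegrable _ _)).symm
  rw [e1, ← intervalIntegral.integral_smul_const, ← intervalIntegral.integral_sub
    (H.continuous_deriv.intervalIntegrable _ _)
    (ContinuousOn.intervalIntegrable (u := fun t : ℝ => (t ^ n)⁻¹ • r ^ n • g₁ r)
      (hci.smul continuousOn_const))]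
  refine (intervalIntegral.norm_integral_le_of_norm_le_const (C := 2 ^ n * d) ?_).trans ?_
  · intro t ht
    rw [uIoc_of_le h₁₂] at ht
    have ht1 : r ≤ t := h₁.1.trans ht.1.le
    have ht2 : t ≤ r + 1 := ht.2.trans h₂.2
    have ht0 : 0 < t := by linarith
    -- Here `t ≤ r + 1 ≤ 2 * r`, since `r ≥ 1`.
    have hM : (t - r) * t ^ n ≤ 2 ^ n * r ^ n := by
      rw [← mul_pow]
      calc (t - r) * t ^ n ≤ 1 * t ^ n := by gcongr; linarith
        _ ≤ (2 * r) ^ n := by rw [one_mul]; gcongr; linarith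
    have hp := H.norm_flux_sub_le hr0.le ht1 hM hd
    have hdd : 2 ^ n * r ^ n = 2 ^ n / d ^ 2 := by
      rw [eq_div_iff (by positivity), mul_assoc, mul_comm (r ^ n), hdr, mul_one]
    have h2n : (1 : ℝ) ≤ 2 ^ n := one_le_pow₀ (by norm_num)
    have hp2 : ‖(t ^ n) • g₁ t - (r ^ n) • g₁ r‖ ≤ 2 ^ n / d := by
      refine hp.trans ?_
      rw [hdd, show d * (2 ^ n / d ^ 2) = 2 ^ n / d by field_simp]
      have : 1 / d ≤ 2 ^ n / d := by gcongr
      linarith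
    have e2 : g₁ t - (t ^ n)⁻¹ • r ^ n • g₁ r = (t ^ n)⁻¹ • ((t ^ n) • g₁ t - (r ^ n) • g₁ r) := by
      rw [smul_sub, inv_smul_smul₀ (by positivity)]
    rw [e2, norm_smul, Real.norm_of_nonneg (by positivity)]
    have h3 : (t ^ n)⁻¹ ≤ d ^ 2 := by
      rw [inv_le_iff_one_le_mul₀ (by positivity), ← hdr]
      gcongr
    calc (t ^ n)⁻¹ * ‖(t ^ n) • g₁ t - (r ^ n) • g₁ r‖ ≤ d ^ 2 * (2 ^ n / d) := by gcongr
      _ = 2 ^ n * d := by field_simp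
  · rw [abs_of_nonneg (by linarith)]
    have : s₂ - s₁ ≤ 1 := by linarith [h₂.2, h₁.1]
    calc 2 ^ n * d * (s₂ - s₁) ≤ 2 ^ n * d * 1 := by gcongr
      _ = _ := mul_one _

/-- With `d = r ^ (-n / 2)`, the profile is at most `2 * d` at a point of the first third and at a
point of the last third of `[r, r + 1]`. The harmonic comparison between them bounds the flux at
`r`, and the same comparison from `r` to the first point bounds `g r`. The summands of the constant
are the sampled value, the flux term and the comparison error. -/
theorem norm_le_of_one_le_aux (H : RadialProfile n 1 1 g g₁ h) {r d : ℝ} (hr : 1 ≤ r) (hd : 0 < d)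
    (hdr : d ^ 2 * r ^ n = 1) :
    ‖g r‖ ≤ (2 + 3 * 2 ^ n * (4 + 2 ^ n) + 2 ^ n) * d := by
  have hr0 : 0 < r := by linarith
  -- The level `2 * d` works because an interval of length `1 / 3` would carry mass at least `4 / 3
  -- > 1`.
  obtain ⟨s₁, hs₁, hg₁⟩ := H.exists_norm_le (a := r) (c := r + 1 / 3) (d := 2 * d) hr0 (by linarith)
    (by positivity) (by nlinarith)
  have hle : d ^ 2 * r ^ n ≤ d ^ 2 * (r + 2 / 3) ^ n := by gcongr; linarith
  obtain ⟨s₂, hs₂, hg₂⟩ := H.exists_norm_le (a := r + 2 / 3) (c := r + 1) (d := 2 * d)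
    (by linarith) (by linarith) (by positivity) (by nlinarith)
  have hI₁ : s₁ ∈ Icc r (r + 1) := ⟨hs₁.1, by linarith [hs₁.2]⟩
  have hI₂ : s₂ ∈ Icc r (r + 1) := ⟨by linarith [hs₂.1], hs₂.2⟩
  have h₁₂ : s₁ ≤ s₂ := by linarith [hs₁.2, hs₂.1]
  have hr1 : 0 < r ^ n := by positivity
  set p := (r ^ n) • g₁ r with hp
  have hint : ∀ a c : ℝ, r ≤ a → a ≤ c →
      IntervalIntegrable (fun t : ℝ => (t ^ n)⁻¹) volume a c := by
    intro a c ha hac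
    refine ContinuousOn.intervalIntegrable (ContinuousOn.inv₀ (by fun_prop) fun t ht => ?_)
    rw [uIcc_of_le hac] at ht
    have : 0 < t := by linarith [ht.1]
    positivity
  have B := H.norm_sub_sub_le hr hd hdr hI₁ hI₂ h₁₂
  have B' := H.norm_sub_sub_le hr hd hdr (s₁ := r) ⟨le_rfl, by linarith⟩ hI₁ hs₁.1
  set c := ∫ t in s₁..s₂, (t ^ n)⁻¹ with hc
  set c' := ∫ t in r..s₁, (t ^ n)⁻¹ with hc'
  -- The sample points are at least `1 / 3` apart, so the flux coefficient is bounded below and can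
  -- be divided out.
  have hclow : 1 / 3 * (2 ^ n * r ^ n)⁻¹ ≤ c := by
    have : ∫ t in s₁..s₂, (2 ^ n * r ^ n)⁻¹ ≤ c := by
      refine intervalIntegral.integral_mono_on h₁₂ (by simp) (hint _ _ hI₁.1 h₁₂) ?_
      intro t ht
      have ht0 : 0 < t := by linarith [ht.1, hI₁.1]
      rw [← mul_pow]
      gcongr
      linarith [ht.2, hI₂.2]
    rw [intervalIntegral.integral_const, smul_eq_mul] at this
    refine le_trans ?_ this
    gcongr
    linarith [hs₁.2, hs₂.1]
  have hc'up : c' ≤ (r ^ n)⁻¹ := by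
    have : c' ≤ ∫ t in r..s₁, (r ^ n)⁻¹ := by
      refine intervalIntegral.integral_mono_on hs₁.1 (hint _ _ le_rfl hs₁.1) (by simp) ?_
      intro t ht
      have := ht.1
      gcongr
    rw [intervalIntegral.integral_const, smul_eq_mul] at this
    refine this.trans (mul_le_of_le_one_left (by positivity) (by linarith [hI₁.2]))
  have hc'0 : 0 ≤ c' := intervalIntegral.integral_nonneg hs₁.1 fun t ht => by
    have : 0 < t := by linarith [ht.1]
    positivity
  have hc0 : 0 ≤ c := le_trans (by positivity) hclow
  have hcp : c * ‖p‖ ≤ (4 + 2 ^ n) * d := by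
    have e : c • p = (g s₂ - g s₁) - (g s₂ - g s₁ - c • p) := by abel
    have : ‖c • p‖ = c * ‖p‖ := by rw [norm_smul, Real.norm_of_nonneg hc0]
    rw [← this, e]
    refine (norm_sub_le _ _).trans ?_
    linarith [norm_sub_le (g s₂) (g s₁)]
  have hpn : ‖p‖ * (r ^ n)⁻¹ ≤ 3 * 2 ^ n * (4 + 2 ^ n) * d := by
    have := (mul_le_mul_of_nonneg_right hclow (norm_nonneg p)).trans hcp
    calc ‖p‖ * (r ^ n)⁻¹ = 3 * 2 ^ n * (1 / 3 * (2 ^ n * r ^ n)⁻¹ * ‖p‖) := by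
          field_simp
      _ ≤ 3 * 2 ^ n * ((4 + 2 ^ n) * d) := by gcongr
      _ = _ := by ring
  have e : g r = g s₁ - c' • p - (g s₁ - g r - c' • p) := by abel
  rw [e]
  refine (norm_sub_le _ _).trans ?_
  have : ‖c' • p‖ ≤ ‖p‖ * (r ^ n)⁻¹ := by
    rw [norm_smul, Real.norm_of_nonneg hc'0, mul_comm]
    gcongr
  linarith [norm_sub_le (g s₁) (c' • p)]

theorem norm_le_of_one_le (H : RadialProfile n 1 1 g g₁ h) {r : ℝ} (hr : 1 ≤ r) :
    ‖g r‖ ≤ (2 + 3 * 2 ^ n * (4 + 2 ^ n) + 2 ^ n) * r ^ (-(n : ℝ) / 2) := by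
  have hr0 : 0 < r := by linarith
  refine H.norm_le_of_one_le_aux hr (Real.rpow_pos_of_pos hr0 _) ?_
  rw [← Real.rpow_natCast _ 2, ← Real.rpow_mul hr0.le, ← Real.rpow_natCast r n,
    ← Real.rpow_add hr0]
  norm_num

/-- Integrate the derivative bound from `r` to `1`, after weakening its exponent to `-1 - γ`. Taking
`γ > 0` avoids the logarithm at `n = 3` and treats all dimensions alike. -/
theorem norm_le_of_le_one (H : RadialProfile n 1 1 g g₁ h) (hn : n ≠ 0) {γ : ℝ} (hγ : 0 < γ)
    (hγn : ((n : ℝ) - 3) / 2 ≤ γ) {r : ℝ} (hr0 : 0 < r) (hr : r ≤ 1) :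
    ‖g r‖ ≤ (2 + 3 * 2 ^ n * (4 + 2 ^ n) + 2 ^ n + 1 / γ) * r ^ (-γ) := by
  have hpos : ∀ t ∈ uIcc r 1, 0 < t := fun t ht => by
    rw [uIcc_of_le hr] at ht
    linarith [ht.1]
  have e1 : ∫ t in r..1, g₁ t = g 1 - g r :=
    intervalIntegral.integral_eq_sub_of_hasDerivAt (fun t ht => H.hasDerivAt t (hpos t ht))
      (H.continuous_deriv.intervalIntegrable _ _)
  have h0 : (0 : ℝ) ∉ uIcc r 1 := fun h => (hpos 0 h).false
  have h2 : ‖∫ t in r..1, g₁ t‖ ≤ ∫ t in r..1, t ^ (-1 - γ) := by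
    refine intervalIntegral.norm_integral_le_of_norm_le hr ?_
      (intervalIntegral.intervalIntegrable_rpow (Or.inr h0))
    refine Eventually.of_forall fun t ht => ?_
    have ht0 : 0 < t := hr0.trans ht.1
    exact (H.norm_deriv_le hn ht0).trans
      (Real.rpow_le_rpow_of_exponent_ge ht0 ht.2 (by linarith))
  rw [integral_rpow (Or.inr ⟨by linarith, h0⟩), e1, Real.one_rpow,
    show -1 - γ + 1 = -γ by ring] at h2
  have h3 : (1 - r ^ (-γ)) / -γ ≤ 1 / γ * r ^ (-γ) := by
    rw [div_neg, ← neg_div, div_le_iff₀ hγ]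
    field_simp
    linarith
  have h4 := H.norm_le_of_one_le le_rfl
  rw [Real.one_rpow, mul_one] at h4
  have h5 : 1 ≤ r ^ (-γ) := Real.one_le_rpow_of_pos_of_le_one_of_nonpos hr0 hr (by linarith)
  have h6 : ‖g r‖ ≤ ‖g 1‖ + ‖g 1 - g r‖ := by
    calc ‖g r‖ = ‖g 1 - (g 1 - g r)‖ := by rw [sub_sub_cancel]
      _ ≤ _ := norm_sub_le _ _
  have h7 : (2 + 3 * 2 ^ n * (4 + 2 ^ n) + 2 ^ n : ℝ) * 1 ≤
    (2 + 3 * 2 ^ n * (4 + 2 ^ n) + 2 ^ n) * r ^ (-γ) := by gcongr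
  rw [add_mul _ (1 / γ)]
  linarith

end RadialProfile

/-! ### The integral inequality for profiles, and scaling. -/

namespace RadialProfile

variable {n : ℕ} {g g₁ h : ℝ → ℂ}

theorem continuousOn {A B : ℝ} (H : RadialProfile n A B g g₁ h) : ContinuousOn g (Ioi 0) :=
  fun r hr => (H.hasDerivAt r hr).continuousAt.continuousWithinAt

theorem exists_integral_rpow_le_of_unit (hn : n ≠ 0) {b q γ : ℝ} (hq : 1 ≤ q)
    (hbq : b ≤ n * (q - 1) / 2) (hγ : 0 < γ) (hγn : ((n : ℝ) - 3) / 2 ≤ γ)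
    (hγq : γ * (1 + q) < b + n + 1) :
    ∃ C : ℝ, 0 ≤ C ∧ ∀ g g₁ h : ℝ → ℂ, RadialProfile n 1 1 g g₁ h →
      IntegrableOn (fun r => r ^ n * (r ^ b * ‖g r‖ ^ (1 + q))) (Ioi 0) ∧
      ∫ r in Ioi 0, r ^ n * (r ^ b * ‖g r‖ ^ (1 + q)) ≤ C := by
  set K : ℝ := 2 + 3 * 2 ^ n * (4 + 2 ^ n) + 2 ^ n with hK
  have hK0 : 0 < K := by positivity
  set K' : ℝ := K + 1 / γ with hK'
  have hK'0 : 0 < K' := by positivity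
  -- The exponent of the dominating power on `(0, 1]`; `hγq` says exactly that it is integrable at
  -- `0`.
  set κ : ℝ := n + b - γ * (1 + q) with hκ
  have hκ1 : -1 < κ := by rw [hκ]; linarith
  have hind : IntegrableOn (indicator (Ioc (0 : ℝ) 1) fun r : ℝ => K' ^ (1 + q) * r ^ κ)
      (Ioi 0) := by
    refine IntegrableOn.integrable (s := Ioi 0) ?_
    refine IntegrableOn.integrable ?_
    rw [IntegrableOn, integrable_indicator_iff measurableSet_Ioc, IntegrableOn,
      Measure.restrict_restrict measurableSet_Ioc, inter_eq_left.2 Ioc_subset_Ioi_self]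
    exact ((intervalIntegrable_iff_integrableOn_Ioc_of_le zero_le_one).1
      (intervalIntegral.intervalIntegrable_rpow' hκ1)).const_mul _
  refine ⟨K ^ (q - 1) + ∫ r in Ioi 0, indicator (Ioc (0 : ℝ) 1)
    (fun r : ℝ => K' ^ (1 + q) * r ^ κ) r, ?_, fun g g₁ h H => ?_⟩
  · refine add_nonneg (by positivity) (integral_nonneg fun r => ?_)
    refine indicator_nonneg (fun r hr => ?_) r
    have := hr.1
    positivity
  have hmaj : IntegrableOn (fun r => K ^ (q - 1) * (r ^ n * ‖g r‖ ^ 2) + indicator (Ioc (0 : ℝ) 1)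
      (fun r : ℝ => K' ^ (1 + q) * r ^ κ) r) (Ioi 0) := (H.integrableOn.const_mul _).add hind
  have hbound : ∀ r ∈ Ioi (0 : ℝ), r ^ n * (r ^ b * ‖g r‖ ^ (1 + q)) ≤
      K ^ (q - 1) * (r ^ n * ‖g r‖ ^ 2) + indicator (Ioc (0 : ℝ) 1)
      (fun r : ℝ => K' ^ (1 + q) * r ^ κ) r := by
    intro r hr
    have hr0 : 0 < r := hr
    rcases le_or_gt r 1 with hr1 | hr1
    · rw [indicator_of_mem (show r ∈ Ioc (0 : ℝ) 1 from ⟨hr0, hr1⟩)]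
      refine le_trans ?_ (le_add_of_nonneg_left (by positivity))
      have h1 : ‖g r‖ ^ (1 + q) ≤ (K' * r ^ (-γ)) ^ (1 + q) :=
        Real.rpow_le_rpow (norm_nonneg _) (H.norm_le_of_le_one hn hγ hγn hr0 hr1) (by linarith)
      rw [Real.mul_rpow hK'0.le (by positivity), ← Real.rpow_mul hr0.le] at h1
      calc r ^ n * (r ^ b * ‖g r‖ ^ (1 + q))
          ≤ r ^ n * (r ^ b * (K' ^ (1 + q) * r ^ (-γ * (1 + q)))) := by gcongr
        _ = K' ^ (1 + q) * (r ^ (n : ℝ) * r ^ b * r ^ (-γ * (1 + q))) := by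
            rw [Real.rpow_natCast]; ring
        _ = K' ^ (1 + q) * r ^ κ := by
            rw [← Real.rpow_add hr0, ← Real.rpow_add hr0, hκ]; ring_nf
    · rw [indicator_of_notMem (fun h => hr1.not_ge h.2), add_zero]
      have h1 : ‖g r‖ ^ (q - 1) ≤ (K * r ^ (-(n : ℝ) / 2)) ^ (q - 1) :=
        Real.rpow_le_rpow (norm_nonneg _) (H.norm_le_of_one_le hr1.le) (by linarith)
      rw [Real.mul_rpow hK0.le (by positivity), ← Real.rpow_mul hr0.le] at h1
      -- The decay of `‖g‖ ^ (q - 1)` compensates the growing weight; this is the role of `hbq`.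
      have h2 : r ^ b * r ^ (-(n : ℝ) / 2 * (q - 1)) ≤ 1 := by
        rw [← Real.rpow_add hr0]
        exact Real.rpow_le_one_of_one_le_of_nonpos hr1.le (by linarith)
      have h3 : ‖g r‖ ^ (1 + q) = ‖g r‖ ^ (q - 1) * ‖g r‖ ^ 2 := by
        rw [← Real.rpow_natCast _ 2, ← Real.rpow_add_of_nonneg (norm_nonneg _) (by linarith)
          (by norm_num)]
        congr 1
        push_cast
        ring
      rw [h3]
      calc r ^ n * (r ^ b * (‖g r‖ ^ (q - 1) * ‖g r‖ ^ 2))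
          ≤ r ^ n * (r ^ b * ((K ^ (q - 1) * r ^ (-(n : ℝ) / 2 * (q - 1))) * ‖g r‖ ^ 2)) := by
            gcongr
        _ = r ^ b * r ^ (-(n : ℝ) / 2 * (q - 1)) * (K ^ (q - 1) * (r ^ n * ‖g r‖ ^ 2)) := by ring
        _ ≤ 1 * (K ^ (q - 1) * (r ^ n * ‖g r‖ ^ 2)) := by gcongr
        _ = _ := one_mul _
  have hint : IntegrableOn (fun r => r ^ n * (r ^ b * ‖g r‖ ^ (1 + q))) (Ioi 0) := by
    refine hmaj.mono' ?_ ?_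
    · refine ContinuousOn.aestronglyMeasurable ?_ measurableSet_Ioi
      refine (by fun_prop : ContinuousOn (fun r : ℝ => r ^ n) (Ioi 0)).mul (ContinuousOn.mul ?_ ?_)
      · exact fun r hr => (Real.continuousAt_rpow_const r b
          (Or.inl (ne_of_gt hr))).continuousWithinAt
      · exact H.continuousOn.norm.rpow_const fun r hr => Or.inr (by linarith)
    · filter_upwards [ae_restrict_mem measurableSet_Ioi] with r hr
      have : (0 : ℝ) < r := hr
      rw [Real.norm_of_nonneg (by positivity)]
      exact hbound r hr
  refine ⟨hint, ?_⟩
  calc ∫ r in Ioi 0, r ^ n * (r ^ b * ‖g r‖ ^ (1 + q))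
      ≤ ∫ r in Ioi 0, (K ^ (q - 1) * (r ^ n * ‖g r‖ ^ 2) + indicator (Ioc (0 : ℝ) 1)
        (fun r : ℝ => K' ^ (1 + q) * r ^ κ) r) := setIntegral_mono_on hint hmaj measurableSet_Ioi
          hbound
    _ = K ^ (q - 1) * (∫ r in Ioi 0, r ^ n * ‖g r‖ ^ 2) + _ := by
        rw [integral_add (H.integrableOn.const_mul _) hind, integral_const_mul]
    _ ≤ K ^ (q - 1) * 1 + _ := by
        gcongr
        simpa using H.integral_le
    _ = _ := by rw [mul_one]

theorem integrableOn_comp_mul (f : ℝ → ℂ) {l : ℝ} (hl : 0 < l) (a : ℝ)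
    (hf : IntegrableOn (fun r => r ^ n * ‖f r‖ ^ 2) (Ioi 0)) :
    IntegrableOn (fun r => r ^ n * ‖(a : ℂ) * f (l * r)‖ ^ 2) (Ioi 0) ∧
    ∫ r in Ioi 0, r ^ n * ‖(a : ℂ) * f (l * r)‖ ^ 2 =
      a ^ 2 * (l ^ (n + 1))⁻¹ * ∫ r in Ioi 0, r ^ n * ‖f r‖ ^ 2 := by
  have e : (fun r => r ^ n * ‖(a : ℂ) * f (l * r)‖ ^ 2) =
      fun r => (a ^ 2 * (l ^ n)⁻¹) * ((l * r) ^ n * ‖f (l * r)‖ ^ 2) := by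
    funext r
    rw [norm_mul, mul_pow, mul_pow, Complex.norm_real, Real.norm_eq_abs, sq_abs]
    field_simp
  rw [e]
  constructor
  · refine Integrable.const_mul ?_ _
    have := (integrableOn_Ioi_comp_mul_left_iff (fun r => r ^ n * ‖f r‖ ^ 2) 0 hl).2
    rw [mul_zero] at this
    exact this hf
  · rw [integral_const_mul, integral_comp_mul_left_Ioi (fun r => r ^ n * ‖f r‖ ^ 2) 0 hl,
      mul_zero, smul_eq_mul, pow_succ]
    field_simp [hl.ne']
    try ring

/-- The condition `hal` normalizes the norm of the function; `hlAB` then normalizes that of its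
Laplacian. -/
theorem rescale {A B : ℝ} (H : RadialProfile n A B g g₁ h)
    {a l : ℝ} (hl : 0 < l) (hal : a ^ 2 * A ^ 2 = l ^ (n + 1)) (hlAB : l ^ 2 * B = A) :
    RadialProfile n 1 1 (fun r => (a : ℂ) * g (l * r)) (fun r => (a : ℂ) * (l * g₁ (l * r)))
      (fun r => ((a * l ^ 2 : ℝ) : ℂ) * h (l * r)) where
  hasDerivAt r hr := by
    have h1 : HasDerivAt (fun s : ℝ => l * s) l r := by
      simpa using (hasDerivAt_id r).const_mul l
    have := ((H.hasDerivAt (l * r) (by positivity)).scomp r h1).const_mul (a : ℂ)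
    simpa [Function.comp_def] using this
  hasDerivAt_flux r hr := by
    have h1 : HasDerivAt (fun s : ℝ => l * s) l r := by
      simpa using (hasDerivAt_id r).const_mul l
    have := ((H.hasDerivAt_flux (l * r) (by positivity)).scomp r h1).const_mul
      ((a * l / l ^ n : ℝ) : ℂ)
    have hl' : (l : ℂ) ≠ 0 := by exact_mod_cast hl.ne'
    refine (this.congr_deriv ?_).congr_of_eventuallyEq (Eventually.of_forall fun s => ?_)
    · simp only [Complex.real_smul]
      push_cast
      field_simp
      ring
    · simp only [Complex.real_smul, Function.comp_def]
      push_cast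
      field_simp
      ring
  continuous_deriv := by
    have := H.continuous_deriv
    fun_prop
  continuous_laplacian := by
    have := H.continuous_laplacian
    fun_prop
  integrableOn := (integrableOn_comp_mul g hl a H.integrableOn).1
  integral_le := by
    rw [(integrableOn_comp_mul g hl a H.integrableOn).2]
    calc a ^ 2 * (l ^ (n + 1))⁻¹ * ∫ r in Ioi 0, r ^ n * ‖g r‖ ^ 2
        ≤ a ^ 2 * (l ^ (n + 1))⁻¹ * A ^ 2 := by gcongr; exact H.integral_le
      _ = (a ^ 2 * A ^ 2) * (l ^ (n + 1))⁻¹ := by ring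
      _ = 1 ^ 2 := by rw [hal]; field_simp
  integrableOn_laplacian := (integrableOn_comp_mul h hl _ H.integrableOn_laplacian).1
  integral_laplacian_le := by
    rw [(integrableOn_comp_mul h hl _ H.integrableOn_laplacian).2]
    calc (a * l ^ 2) ^ 2 * (l ^ (n + 1))⁻¹ * ∫ r in Ioi 0, r ^ n * ‖h r‖ ^ 2
        ≤ (a * l ^ 2) ^ 2 * (l ^ (n + 1))⁻¹ * B ^ 2 := by gcongr; exact H.integral_laplacian_le
      _ = (a ^ 2 * (l ^ 2 * B) ^ 2) * (l ^ (n + 1))⁻¹ := by ring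
      _ = 1 ^ 2 := by rw [hlAB, hal]; field_simp

theorem exists_integral_rpow_le (hn : n ≠ 0) {b q γ : ℝ} (hq : 1 ≤ q)
    (hbq : b ≤ n * (q - 1) / 2) (hγ : 0 < γ) (hγn : ((n : ℝ) - 3) / 2 ≤ γ)
    (hγq : γ * (1 + q) < b + n + 1) :
    ∃ C : ℝ, 0 ≤ C ∧ ∀ (A B : ℝ) (g g₁ h : ℝ → ℂ), 0 < A → 0 < B → RadialProfile n A B g g₁ h →
      IntegrableOn (fun r => r ^ n * (r ^ b * ‖g r‖ ^ (1 + q))) (Ioi 0) ∧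
      ∫ r in Ioi 0, r ^ n * (r ^ b * ‖g r‖ ^ (1 + q)) ≤
        C * A ^ (1 + q - gnExponent (n + 1) b q) * B ^ gnExponent (n + 1) b q := by
  obtain ⟨C, hC, hunit⟩ := exists_integral_rpow_le_of_unit hn hq hbq hγ hγn hγq
  refine ⟨C, hC, fun A B g g₁ h hA hB H => ?_⟩
  set l : ℝ := (A / B) ^ (1 / 2 : ℝ) with hl
  have hl0 : 0 < l := by positivity
  set a : ℝ := l ^ (((n : ℝ) + 1) / 2) / A with ha
  have ha0 : 0 < a := by positivity
  have hal : a ^ 2 * A ^ 2 = l ^ (n + 1) := by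
    rw [ha, div_pow, div_mul_cancel₀ _ (by positivity), ← Real.rpow_natCast _ 2,
      ← Real.rpow_mul hl0.le, ← Real.rpow_natCast]
    push_cast
    ring_nf
  have hlAB : l ^ 2 * B = A := by
    rw [hl, ← Real.rpow_natCast _ 2, ← Real.rpow_mul (by positivity)]
    norm_num
    field_simp
  obtain ⟨h1, h2⟩ := hunit _ _ _ (H.rescale hl0 hal hlAB)
  set c : ℝ := a ^ (1 + q) * (l ^ n * l ^ b)⁻¹ with hc
  have hc0 : 0 < c := by positivity
  have e : EqOn (fun r => r ^ n * (r ^ b * ‖(a : ℂ) * g (l * r)‖ ^ (1 + q)))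
      (fun r => c * ((l * r) ^ n * ((l * r) ^ b * ‖g (l * r)‖ ^ (1 + q)))) (Ioi 0) := by
    intro r hr
    have hr0 : 0 < r := hr
    simp only [norm_mul, Complex.norm_real, Real.norm_of_nonneg ha0.le]
    rw [Real.mul_rpow ha0.le (norm_nonneg _), Real.mul_rpow hl0.le hr0.le, mul_pow, hc]
    field_simp
  rw [integrableOn_congr_fun e measurableSet_Ioi] at h1
  rw [setIntegral_congr_fun measurableSet_Ioi e, integral_const_mul,
    integral_comp_mul_left_Ioi (fun r => r ^ n * (r ^ b * ‖g r‖ ^ (1 + q))) 0 hl0, mul_zero,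
    smul_eq_mul] at h2
  constructor
  · have h3 : IntegrableOn (fun r => (l * r) ^ n * ((l * r) ^ b * ‖g (l * r)‖ ^ (1 + q)))
        (Ioi 0) := by
      have := h1.const_mul c⁻¹
      simp only [inv_mul_cancel_left₀ hc0.ne'] at this
      exact this
    have := (integrableOn_Ioi_comp_mul_left_iff
      (fun r => r ^ n * (r ^ b * ‖g r‖ ^ (1 + q))) 0 hl0).1 h3
    rwa [mul_zero] at this
  · have h4 : ∫ r in Ioi 0, r ^ n * (r ^ b * ‖g r‖ ^ (1 + q)) ≤ C * (l * c⁻¹) := by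
      have e2 : ∀ I : ℝ, I = (c * (l⁻¹ * I)) * (l * c⁻¹) := fun I => by field_simp
      rw [e2 (∫ r in Ioi 0, _)]
      gcongr
    refine h4.trans (le_of_eq ?_)
    have e3 : a ^ (1 + q) = l ^ (((n : ℝ) + 1) / 2 * (1 + q)) / A ^ (1 + q) := by
      rw [ha, Real.div_rpow (by positivity) hA.le, ← Real.rpow_mul hl0.le]
    -- Collecting the powers of `l` leaves exactly `-2 * D`; since `l ^ 2 = A / B`, this is `(B / A)
    -- ^ D`.
    have e4 : l * c⁻¹ = l ^ (-2 * gnExponent (n + 1) b q) * A ^ (1 + q) := by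
      have e5 : -2 * gnExponent (n + 1) b q =
          1 + n + b - (((n : ℝ) + 1) / 2 * (1 + q)) := by
        rw [gnExponent]
        push_cast
        ring
      rw [hc, e3, e5, Real.rpow_sub hl0, Real.rpow_add hl0, Real.rpow_add hl0, Real.rpow_one,
        Real.rpow_natCast]
      field_simp
    have e6 : l ^ (-2 * gnExponent (n + 1) b q) =
        B ^ gnExponent (n + 1) b q / A ^ gnExponent (n + 1) b q := by
      rw [hl, ← Real.rpow_mul (by positivity), ← Real.div_rpow hB.le hA.le,
        ← inv_div B A, Real.inv_rpow (by positivity), ← Real.rpow_neg (by positivity)]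
      congr 1
      ring
    rw [e4, e6, Real.rpow_sub hA]
    ring

end RadialProfile

/-! ### Convolution with a radial mollifier. -/

/-- A smooth compactly supported radial probability density. -/
structure IsRadialMollifier {E : Type*} [NormedAddCommGroup E] [InnerProductSpace ℝ E]
    [MeasureSpace E] (φ : E → ℝ) : Prop where
  contDiff : ContDiff ℝ ∞ φ
  hasCompactSupport : HasCompactSupport φ
  nonneg : ∀ x, 0 ≤ φ x
  integral_eq_one : ∫ x, φ x = 1
  radial : ∀ x y, ‖x‖ = ‖y‖ → φ x = φ y

section Kernel

variable {E : Type*} [NormedAddCommGroup E] [InnerProductSpace ℝ E]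

theorem contDiff_fderiv_apply {φ : E → ℝ} (hφ : ContDiff ℝ ∞ φ) (m : E) :
    ContDiff ℝ ∞ (fun y => fderiv ℝ φ y m) :=
  (hφ.fderiv_right (by simp)).clm_apply contDiff_const

theorem hasCompactSupport_fderiv_apply {φ : E → ℝ} (hc : HasCompactSupport φ) (m : E) :
    HasCompactSupport (fun y => fderiv ℝ φ y m) := hc.fderiv_apply ℝ m

theorem fderiv_ofReal_comp_sub {φ : E → ℝ} (hφ : Differentiable ℝ φ) (x y m : E) :
    fderiv ℝ (fun z => ((φ (x - z) : ℝ) : ℂ)) y m = ((-fderiv ℝ φ (x - y) m : ℝ) : ℂ) := by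
  have h1 : HasFDerivAt (fun z => x - z) (-ContinuousLinearMap.id ℝ E) y :=
    (hasFDerivAt_id y).const_sub x
  have h2 := Complex.ofRealCLM.hasFDerivAt.comp y ((hφ (x - y)).hasFDerivAt.comp y h1)
  have h3 : HasFDerivAt (fun z => ((φ (x - z) : ℝ) : ℂ)) _ y := h2
  rw [h3.fderiv]
  simp

end Kernel

section Convolution

variable {E : Type*} [NormedAddCommGroup E] [InnerProductSpace ℝ E] [FiniteDimensional ℝ E]
  [MeasurableSpace E] [BorelSpace E]

/-- Convolution of a real kernel with a complex-valued function. -/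
noncomputable abbrev realConv (φ : E → ℝ) (v : E → ℂ) : E → ℂ :=
  φ ⋆[ContinuousLinearMap.lsmul ℝ ℝ, volume] v

theorem realConv_apply (φ : E → ℝ) (v : E → ℂ) (x : E) :
    realConv φ v x = ∫ y, φ (x - y) • v y := by
  rw [realConv, convolution_eq_swap]
  rfl

theorem hasFDerivAt_realConv {φ : E → ℝ} {v : E → ℂ} (hc : HasCompactSupport φ)
    (hφ : ContDiff ℝ ∞ φ) (hv : LocallyIntegrable v) (x : E) :
    ∃ D : E →L[ℝ] ℂ, HasFDerivAt (realConv φ v) D x ∧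
      ∀ m, D m = realConv (fun y => fderiv ℝ φ y m) v x := by
  refine ⟨_, hc.hasFDerivAt_convolution_left _ (hφ.of_le (by exact_mod_cast le_top)) hv x,
    fun m => ?_⟩
  have hex := (hc.fderiv ℝ).convolutionExists_left
    (ContinuousLinearMap.precompL E (ContinuousLinearMap.lsmul ℝ ℝ : ℝ →L[ℝ] ℂ →L[ℝ] ℂ))
    (hφ.continuous_fderiv (by simp)) hv x
  rw [convolution_def, ContinuousLinearMap.integral_apply hex]
  rfl

theorem hasDerivAt_realConv_line {φ : E → ℝ} {v : E → ℂ} (hc : HasCompactSupport φ)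
    (hφ : ContDiff ℝ ∞ φ) (hv : LocallyIntegrable v) (x m : E) (t : ℝ) :
    HasDerivAt (fun s : ℝ => realConv φ v (x + s • m))
      (realConv (fun y => fderiv ℝ φ y m) v (x + t • m)) t := by
  obtain ⟨D, hD, hDm⟩ := hasFDerivAt_realConv hc hφ hv (x + t • m)
  rw [← hDm]
  have h1 : HasDerivAt (fun s : ℝ => x + s • m) m t := by
    simpa using ((hasDerivAt_id t).smul_const m).const_add x
  exact hD.comp_hasDerivAt t h1

theorem continuous_realConv {φ : E → ℝ} {v : E → ℂ} (hc : HasCompactSupport φ)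
    (hφ : Continuous φ) (hv : LocallyIntegrable v) : Continuous (realConv φ v) :=
  hc.continuous_convolution_left _ hφ hv

/-- The second derivatives of a mollification sum up to the mollification of the distributional
Laplacian. -/
theorem sum_realConv_fderiv_fderiv {φ : E → ℝ} (hc : HasCompactSupport φ) (hφ : ContDiff ℝ ∞ φ)
    {v w : Lp ℂ 2 (volume : Measure E)} (hvw : Δ (v : 𝓢'(E, ℂ)) = (w : 𝓢'(E, ℂ)))
    {ι : Type*} [Fintype ι] (e : OrthonormalBasis ι ℝ E) (x : E) :
    ∑ i, realConv (fun y => fderiv ℝ (fun z => fderiv ℝ φ z (e i)) y (e i)) v x =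
      realConv φ w x := by
  have hd : ContDiff ℝ ∞ (fun z => ((φ (x - z) : ℝ) : ℂ)) :=
    Complex.ofRealCLM.contDiff.comp (hφ.comp (contDiff_const.sub contDiff_id))
  have hcs : HasCompactSupport (fun z => ((φ (x - z) : ℝ) : ℂ)) := by
    have : HasCompactSupport (fun z => φ (x - z)) :=
      hc.comp_homeomorph (Homeomorph.subLeft x)
    exact this.comp_left (g := fun r : ℝ => (r : ℂ)) (by simp)
  -- The identity `Δ v = w` is tested against `y ↦ φ (x - y)`; the signs from differentiating twice
  -- in `y` cancel.
  set ψ : 𝓢(E, ℂ) := hcs.toSchwartzMap hd with hψ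
  have hψa : ∀ y, ψ y = ((φ (x - y) : ℝ) : ℂ) := fun y => rfl
  have hv : LocallyIntegrable v := (Lp.memLp v).locallyIntegrable (by norm_num)
  have key := congrArg (fun T : 𝓢'(E, ℂ) => T ψ) hvw
  simp only [laplacian_apply_apply, Lp.toTemperedDistribution_apply] at key
  have hlap : ∀ y, (Δ ψ) y =
      ∑ i, ((fderiv ℝ (fun z => fderiv ℝ φ z (e i)) (x - y) (e i) : ℝ) : ℂ) := by
    intro y
    rw [SchwartzMap.laplacian_eq_sum e, sum_apply]
    refine Finset.sum_congr rfl fun i _ => ?_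
    rw [SchwartzMap.lineDerivOp_apply_eq_fderiv]
    have h1 : ((LineDeriv.lineDerivOp (e i) ψ : 𝓢(E, ℂ)) : E → ℂ) =
        fun z => (((fun u => -fderiv ℝ φ u (e i)) (x - z) : ℝ) : ℂ) := by
      funext z
      rw [SchwartzMap.lineDerivOp_apply_eq_fderiv]
      exact fderiv_ofReal_comp_sub (hφ.differentiable (by simp)) x z (e i)
    rw [h1, fderiv_ofReal_comp_sub
      ((contDiff_fderiv_apply hφ (e i)).neg.differentiable (by simp)), fderiv_fun_neg]
    simp
  have hR : ∫ y, ψ y • w y = realConv φ w x := by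
    rw [realConv_apply]
    rfl
  rw [← hR, ← key]
  simp_rw [hlap, Finset.sum_smul]
  rw [integral_finsetSum]
  · refine Finset.sum_congr rfl fun i _ => ?_
    rw [realConv_apply]
    rfl
  · intro i _
    have hex := (hasCompactSupport_fderiv_apply (hasCompactSupport_fderiv_apply hc (e i))
      (e i)).convolutionExists_left (ContinuousLinearMap.lsmul ℝ ℝ : ℝ →L[ℝ] ℂ →L[ℝ] ℂ)
      (contDiff_fderiv_apply (contDiff_fderiv_apply hφ (e i)) (e i)).continuous hv x
    exact hex.integrable_swap

theorem realConv_eq_of_norm_eq {φ : E → ℝ} (hφ : ∀ x y, ‖x‖ = ‖y‖ → φ x = φ y) {v : E → ℂ}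
    {f : ℝ → ℂ} (hv : ∀ᵐ x, v x = f ‖x‖) {x y : E} (hxy : ‖x‖ = ‖y‖) :
    realConv φ v x = realConv φ v y := by
  have h0 : ∀ x, realConv φ v x = ∫ y, φ (x - y) • f ‖y‖ := fun x => by
    rw [realConv_apply]
    refine integral_congr_ae ?_
    filter_upwards [hv] with y hy
    rw [hy]
  rw [h0, h0]
  -- Reflection in the hyperplane orthogonal to `x - y` exchanges `x` and `y`, and preserves the
  -- kernel, the radial function and the measure.
  let R : E ≃ₗᵢ[ℝ] E := (ℝ ∙ (x - y))ᗮ.reflection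
  have hR : R x = y := Submodule.reflection_sub hxy
  rw [← R.measurePreserving.integral_comp R.toHomeomorph.measurableEmbedding
    (fun z => φ (y - z) • f ‖z‖)]
  refine integral_congr_ae (Eventually.of_forall fun z => ?_)
  simp only
  rw [R.norm_map, ← hR, ← map_sub, hφ _ _ (R.norm_map (x - z))]

theorem IsRadialMollifier.integrable {φ : E → ℝ} (hφ : IsRadialMollifier φ) : Integrable φ :=
  hφ.contDiff.continuous.integrable_of_hasCompactSupport hφ.hasCompactSupport

theorem IsRadialMollifier.norm_sq_realConv_le {φ : E → ℝ} (hφ : IsRadialMollifier φ) {v : E → ℂ}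
    (hv : MemLp v 2) (x : E) :
    ‖realConv φ v x‖ ^ 2 ≤
      (φ ⋆[ContinuousLinearMap.lsmul ℝ ℝ, volume] fun y => ‖v y‖ ^ 2) x := by
  have hv2 : LocallyIntegrable fun y => ‖v y‖ ^ 2 := hv.norm.integrable_sq.locallyIntegrable
  have hi1 : Integrable fun y => φ (x - y) • ‖v y‖ :=
    (hφ.hasCompactSupport.convolutionExists_left (ContinuousLinearMap.lsmul ℝ ℝ)
      hφ.contDiff.continuous (hv.norm.locallyIntegrable (by norm_num)) x).integrable_swap
  have hi2 : Integrable fun y => φ (x - y) • ‖v y‖ ^ 2 :=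
    (hφ.hasCompactSupport.convolutionExists_left (ContinuousLinearMap.lsmul ℝ ℝ)
      hφ.contDiff.continuous hv2 x).integrable_swap
  have hi0 : Integrable fun y => φ (x - y) := hφ.integrable.comp_sub_left x
  have h1 : ∫ y, φ (x - y) = 1 := by
    rw [integral_sub_left_eq_self, hφ.integral_eq_one]
  set m := ∫ y, φ (x - y) • ‖v y‖ with hm
  have h2 : ‖realConv φ v x‖ ≤ m := by
    rw [realConv_apply]
    refine (norm_integral_le_integral_norm _).trans (le_of_eq ?_)
    refine integral_congr_ae (Eventually.of_forall fun y => ?_)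
    simp [abs_of_nonneg (hφ.nonneg _)]
  rw [convolution_eq_swap]
  change _ ≤ ∫ y, φ (x - y) • ‖v y‖ ^ 2
  -- Jensen's inequality for the square, as nonnegativity of a variance for the probability density
  -- `φ (x - ·)`.
  have h3 : 0 ≤ ∫ y, φ (x - y) * (‖v y‖ - m) ^ 2 :=
    integral_nonneg fun y => mul_nonneg (hφ.nonneg _) (sq_nonneg _)
  have h4 : ∫ y, φ (x - y) * (‖v y‖ - m) ^ 2 =
      (∫ y, φ (x - y) • ‖v y‖ ^ 2) - 2 * m * m + m ^ 2 * 1 := by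
    have e : (fun y => φ (x - y) * (‖v y‖ - m) ^ 2) = fun y =>
        φ (x - y) • ‖v y‖ ^ 2 - 2 * m * (φ (x - y) • ‖v y‖) + m ^ 2 * φ (x - y) := by
      funext y
      simp only [smul_eq_mul]
      ring
    have hi3 : Integrable fun y => φ (x - y) • ‖v y‖ ^ 2 - 2 * m * (φ (x - y) • ‖v y‖) :=
      hi2.sub (hi1.const_mul _)
    rw [e, integral_add hi3 (hi0.const_mul _),
      integral_sub hi2 (hi1.const_mul _), integral_const_mul, integral_const_mul, h1, ← hm]
  have h5 : ‖realConv φ v x‖ ^ 2 ≤ m ^ 2 := by gcongr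
  nlinarith

theorem IsRadialMollifier.integrable_norm_sq_realConv {φ : E → ℝ} (hφ : IsRadialMollifier φ)
    {v : E → ℂ} (hv : MemLp v 2) : Integrable (fun x => ‖realConv φ v x‖ ^ 2) := by
  refine (hφ.integrable.integrable_convolution (ContinuousLinearMap.lsmul ℝ ℝ)
    hv.norm.integrable_sq).mono' ?_ (Eventually.of_forall fun x => ?_)
  · exact ((continuous_realConv hφ.hasCompactSupport hφ.contDiff.continuous
      (hv.locallyIntegrable (by norm_num))).norm.pow 2).aestronglyMeasurable
  · rw [Real.norm_of_nonneg (by positivity)]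
    exact hφ.norm_sq_realConv_le hv x

theorem IsRadialMollifier.integral_norm_sq_realConv_le {φ : E → ℝ} (hφ : IsRadialMollifier φ)
    {v : E → ℂ} (hv : MemLp v 2) : ∫ x, ‖realConv φ v x‖ ^ 2 ≤ ∫ x, ‖v x‖ ^ 2 := by
  refine (integral_mono (hφ.integrable_norm_sq_realConv hv)
    (hφ.integrable.integrable_convolution (ContinuousLinearMap.lsmul ℝ ℝ)
    hv.norm.integrable_sq) (hφ.norm_sq_realConv_le hv)).trans (le_of_eq ?_)
  rw [integral_convolution _ hφ.integrable hv.norm.integrable_sq, hφ.integral_eq_one]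
  simp

end Convolution

/-! ### Mollified radial functions in polar coordinates. -/

section Profile

variable {n : ℕ}

theorem hasDerivAt_sqrt_add_sq {r : ℝ} (hr : 0 < r) (t : ℝ) :
    HasDerivAt (fun s : ℝ => √(r ^ 2 + s ^ 2)) (t / √(r ^ 2 + t ^ 2)) t := by
  have h1 : HasDerivAt (fun s : ℝ => r ^ 2 + s ^ 2) (2 * t) t := by
    simpa using (hasDerivAt_pow 2 t).const_add (r ^ 2)
  have := h1.sqrt (by positivity)
  convert this using 1
  field_simp

theorem exists_orthonormalBasis_zero_eq (e : EuclideanSpace ℝ (Fin (n + 1))) (he : ‖e‖ = 1) :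
    ∃ b : OrthonormalBasis (Fin (n + 1)) ℝ (EuclideanSpace ℝ (Fin (n + 1))), b 0 = e := by
  obtain ⟨b, hb⟩ := Orthonormal.exists_orthonormalBasis_extension_of_card_eq (𝕜 := ℝ)
    (E := EuclideanSpace ℝ (Fin (n + 1))) (ι := Fin (n + 1)) (by simp) (v := fun _ => e)
    (s := {0}) (by
      constructor
      · intro i
        simpa using he
      · intro i j hij
        exact absurd (Subsingleton.elim i j) hij)
  exact ⟨b, hb 0 rfl⟩

/-- The Laplacian of a mollified radial function in polar coordinates. -/
theorem hasDerivAt_flux_realConv {φ : EuclideanSpace ℝ (Fin (n + 1)) → ℝ}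
    (hφ : IsRadialMollifier φ) {v w : L2 (n + 1)} (hv : IsRadial v)
    (hvw : Δ (v : 𝓢'(EuclideanSpace ℝ (Fin (n + 1)), ℂ)) =
      (w : 𝓢'(EuclideanSpace ℝ (Fin (n + 1)), ℂ)))
    {e : EuclideanSpace ℝ (Fin (n + 1))} (he : ‖e‖ = 1) {r : ℝ} (hr : 0 < r) :
    HasDerivAt (fun s : ℝ => (s ^ n) • realConv (fun y => fderiv ℝ φ y e) v (s • e))
      ((r ^ n) • realConv φ w (r • e)) r := by
  obtain ⟨f, hf⟩ := hv
  obtain ⟨b, hb⟩ := exists_orthonormalBasis_zero_eq e he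
  have hvl : LocallyIntegrable v := (Lp.memLp v).locallyIntegrable (by norm_num)
  set g : ℝ → ℂ := fun s => realConv φ v (s • e) with hg
  set g₁ : ℝ → ℂ := fun s => realConv (fun y => fderiv ℝ φ y e) v (s • e) with hg₁
  set g₂ : ℝ → ℂ := fun s =>
    realConv (fun y => fderiv ℝ (fun z => fderiv ℝ φ z e) y e) v (s • e) with hg₂
  have hd1 : ∀ s, HasDerivAt g (g₁ s) s := fun s => by
    simpa using hasDerivAt_realConv_line hφ.hasCompactSupport hφ.contDiff hvl 0 e s
  have hd2 : ∀ s, HasDerivAt g₁ (g₂ s) s := fun s => by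
    simpa using hasDerivAt_realConv_line (hasCompactSupport_fderiv_apply hφ.hasCompactSupport e)
      (contDiff_fderiv_apply hφ.contDiff e) hvl 0 e s
  have hrad : ∀ x, realConv φ v x = g ‖x‖ := fun x =>
    realConv_eq_of_norm_eq hφ.radial hf (by simp [norm_smul, he])
  -- Along a tangential line the function is `g (√(r ^ 2 + t ^ 2))`, whose second derivative at `t =
  -- 0` is `g' r / r`. The `n` such directions supply the first-order term of the radial Laplacian.
  have hother : ∀ i, i ≠ 0 →
      realConv (fun y => fderiv ℝ (fun z => fderiv ℝ φ z (b i)) y (b i)) v (r • e) =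
        (r⁻¹ : ℝ) • g₁ r := by
    intro i hi
    have hnorm : ∀ t : ℝ, ‖r • e + t • b i‖ = √(r ^ 2 + t ^ 2) := by
      intro t
      have h0 : inner ℝ (b 0) (b i) = 0 := b.orthonormal.2 (Ne.symm hi)
      rw [← Real.sqrt_sq (norm_nonneg (r • e + t • b i)), norm_add_sq_real, norm_smul, norm_smul,
        he, b.orthonormal.1 i, inner_smul_left, inner_smul_right, ← hb, h0]
      simp
    have hfirst : ∀ t : ℝ, realConv (fun y => fderiv ℝ φ y (b i)) v (r • e + t • b i) =
        t • ((√(r ^ 2 + t ^ 2))⁻¹ • g₁ √(r ^ 2 + t ^ 2)) := by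
      intro t
      have hA := hasDerivAt_realConv_line hφ.hasCompactSupport hφ.contDiff hvl (r • e) (b i) t
      have hB := (hd1 √(r ^ 2 + t ^ 2)).scomp t (hasDerivAt_sqrt_add_sq hr t)
      have hAB : (fun s : ℝ => realConv φ v (r • e + s • b i)) =
          g ∘ fun s : ℝ => √(r ^ 2 + s ^ 2) := by
        funext s
        rw [hrad, hnorm, Function.comp_apply]
      rw [hAB] at hA
      rw [hA.unique hB, smul_smul, div_eq_mul_inv]
    have hA := hasDerivAt_realConv_line (hasCompactSupport_fderiv_apply hφ.hasCompactSupport (b i))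
      (contDiff_fderiv_apply hφ.contDiff (b i)) hvl (r • e) (b i) 0
    have hs := hasDerivAt_sqrt_add_sq hr 0
    have hs0 : √(r ^ 2 + 0 ^ 2) = r := by simp [Real.sqrt_sq hr.le]
    have hm := (hs.inv (by rw [hs0]; exact hr.ne')).smul ((hd2 √(r ^ 2 + 0 ^ 2)).scomp 0 hs)
    have hB := (hasDerivAt_id (0 : ℝ)).smul hm
    rw [show (fun s : ℝ => realConv (fun y => fderiv ℝ φ y (b i)) v (r • e + s • b i)) = _ from
      funext hfirst] at hA
    have := hA.unique hB
    simpa [Real.sqrt_sq hr.le] using this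
  have hsum := sum_realConv_fderiv_fderiv hφ.hasCompactSupport hφ.contDiff hvw b (r • e)
  rw [Fin.sum_univ_succ, hb, Finset.sum_congr rfl fun i _ => hother i.succ (Fin.succ_ne_zero i)]
    at hsum
  have := (hasDerivAt_pow n r).smul (hd2 r)
  refine this.congr_deriv ?_
  rw [← hsum, Finset.sum_const, Finset.card_univ, Fintype.card_fin]
  change _ = r ^ n • (g₂ r + n • r⁻¹ • g₁ r)
  rw [smul_add]
  congr 1
  rcases n with _ | n
  · simp
  · rw [← Nat.cast_smul_eq_nsmul ℝ, smul_smul, smul_smul, Nat.add_sub_cancel, pow_succ]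
    congr 1
    field_simp

/-- The surface area of the unit sphere of `ℝⁿ⁺¹`. -/
noncomputable def sphereArea (n : ℕ) : ℝ :=
  (n + 1) * (volume : Measure (EuclideanSpace ℝ (Fin (n + 1)))).real (Metric.ball 0 1)

theorem sphereArea_pos (n : ℕ) : 0 < sphereArea n := by
  have : 0 < (volume : Measure (EuclideanSpace ℝ (Fin (n + 1)))).real (Metric.ball 0 1) :=
    ENNReal.toReal_pos (Metric.measure_ball_pos _ _ one_pos).ne' measure_ball_lt_top.ne
  unfold sphereArea
  positivity

theorem integral_comp_norm_eq (f : ℝ → ℝ) :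
    ∫ x : EuclideanSpace ℝ (Fin (n + 1)), f ‖x‖ = sphereArea n * ∫ r in Ioi 0, r ^ n * f r := by
  rw [integral_fun_norm_addHaar]
  simp [sphereArea, mul_assoc]

theorem integrable_comp_norm_iff {f : ℝ → ℝ} :
    Integrable (fun x : EuclideanSpace ℝ (Fin (n + 1)) => f ‖x‖) ↔
      IntegrableOn (fun r => r ^ n * f r) (Ioi 0) := by
  rw [integrable_fun_norm_addHaar]
  simp

theorem MeasureTheory.Lp.integral_norm_sq_eq {α : Type*} [MeasurableSpace α] {μ : Measure α}
    (v : Lp ℂ 2 μ) : ∫ x, ‖v x‖ ^ 2 ∂μ = ‖v‖ ^ 2 := by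
  have h := congrArg RCLike.re (L2.inner_def (𝕜 := ℂ) v v)
  rw [← norm_sq_eq_re_inner, ← integral_re (L2.integrable_inner v v)] at h
  rw [h]
  simp only [← norm_sq_eq_re_inner]

theorem exists_radialProfile {φ : EuclideanSpace ℝ (Fin (n + 1)) → ℝ}
    (hφ : IsRadialMollifier φ) {v w : L2 (n + 1)} (hv : IsRadial v)
    (hvw : Δ (v : 𝓢'(EuclideanSpace ℝ (Fin (n + 1)), ℂ)) =
      (w : 𝓢'(EuclideanSpace ℝ (Fin (n + 1)), ℂ)))
    {A B : ℝ} (hA : ‖v‖ ≤ A) (hB : ‖w‖ ≤ B) :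
    ∃ g g₁ h : ℝ → ℂ, (∀ x, realConv φ v x = g ‖x‖) ∧
      RadialProfile n (A / √(sphereArea n)) (B / √(sphereArea n)) g g₁ h := by
  have hvl : LocallyIntegrable v := (Lp.memLp v).locallyIntegrable (by norm_num)
  have hwl : LocallyIntegrable w := (Lp.memLp w).locallyIntegrable (by norm_num)
  set e : EuclideanSpace ℝ (Fin (n + 1)) := EuclideanSpace.single 0 1 with he'
  have he : ‖e‖ = 1 := by simp [he']
  have hrad : ∀ x y, ‖x‖ = ‖y‖ → realConv φ v x = realConv φ v y := fun x y hxy => by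
    obtain ⟨f, hf⟩ := hv
    exact realConv_eq_of_norm_eq hφ.radial hf hxy
  have hderiv : ∀ e' : EuclideanSpace ℝ (Fin (n + 1)), ∀ s : ℝ,
      HasDerivAt (fun s : ℝ => realConv φ v (s • e'))
        (realConv (fun y => fderiv ℝ φ y e') v (s • e')) s := fun e' s => by
    simpa using hasDerivAt_realConv_line hφ.hasCompactSupport hφ.contDiff hvl 0 e' s
  have hg1 : ∀ e' : EuclideanSpace ℝ (Fin (n + 1)), ‖e'‖ = 1 → ∀ s : ℝ,
      realConv (fun y => fderiv ℝ φ y e') v (s • e') =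
        realConv (fun y => fderiv ℝ φ y e) v (s • e) := fun e' he' s => by
    refine (hderiv e' s).unique ?_
    have : (fun s : ℝ => realConv φ v (s • e')) = fun s : ℝ => realConv φ v (s • e) :=
      funext fun s => hrad _ _ (by simp [norm_smul, he, he'])
    rw [this]
    exact hderiv e s
  -- Radiality of `w` is not assumed. It passes to the mollified Laplacian because the flux is the
  -- same along every ray, so its derivative is too.
  have hradw : ∀ x, x ≠ 0 → realConv φ w x = realConv φ w (‖x‖ • e) := fun x hx => by
    have hx0 : 0 < ‖x‖ := norm_pos_iff.2 hx
    have hx1 : ‖(‖x‖⁻¹ • x)‖ = 1 := by rw [norm_smul, norm_inv, norm_norm, inv_mul_cancel₀ hx0.ne']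
    have h1 := hasDerivAt_flux_realConv hφ hv hvw hx1 hx0
    simp_rw [hg1 _ hx1] at h1
    have h2 := h1.unique (hasDerivAt_flux_realConv hφ hv hvw he hx0)
    rw [smul_right_injective _ (pow_pos hx0 n).ne' |>.eq_iff] at h2
    rw [← h2, smul_smul, mul_inv_cancel₀ hx0.ne', one_smul]
  have hω := sphereArea_pos n
  have hIv : (fun x => ‖realConv φ v x‖ ^ 2) = fun x => ‖realConv φ v (‖x‖ • e)‖ ^ 2 :=
    funext fun x => by rw [hrad x (‖x‖ • e) (by simp [norm_smul, he])]
  have hIw : (fun x => ‖realConv φ w x‖ ^ 2) =ᵐ[volume]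
      fun x => ‖realConv φ w (‖x‖ • e)‖ ^ 2 := by
    filter_upwards [compl_mem_ae_iff.2 (measure_singleton (μ := volume)
      (0 : EuclideanSpace ℝ (Fin (n + 1))))] with x hx
    rw [hradw x hx]
  refine ⟨fun s => realConv φ v (s • e), fun s => realConv (fun y => fderiv ℝ φ y e) v (s • e),
    fun s => realConv φ w (s • e), fun x => hrad _ _ (by simp [norm_smul, he]), ?_⟩
  refine ⟨fun r _ => hderiv e r, fun r hr => hasDerivAt_flux_realConv hφ hv hvw he hr,
    ?_, ?_, ?_, ?_, ?_, ?_⟩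
  · exact (continuous_realConv (hasCompactSupport_fderiv_apply hφ.hasCompactSupport e)
      (contDiff_fderiv_apply hφ.contDiff e).continuous hvl).comp (by fun_prop)
  · exact (continuous_realConv hφ.hasCompactSupport hφ.contDiff.continuous hwl).comp (by fun_prop)
  · rw [← integrable_comp_norm_iff (f := fun r => ‖realConv φ v (r • e)‖ ^ 2), ← hIv]
    exact hφ.integrable_norm_sq_realConv (Lp.memLp v)
  · rw [div_pow, Real.sq_sqrt hω.le, le_div_iff₀' hω,
      ← integral_comp_norm_eq (fun r => ‖realConv φ v (r • e)‖ ^ 2), ← hIv]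
    refine (hφ.integral_norm_sq_realConv_le (Lp.memLp v)).trans ?_
    rw [Lp.integral_norm_sq_eq]
    gcongr
  · rw [← integrable_comp_norm_iff (f := fun r => ‖realConv φ w (r • e)‖ ^ 2),
      ← integrable_congr hIw]
    exact hφ.integrable_norm_sq_realConv (Lp.memLp w)
  · rw [div_pow, Real.sq_sqrt hω.le, le_div_iff₀' hω,
      ← integral_comp_norm_eq (fun r => ‖realConv φ w (r • e)‖ ^ 2), ← integral_congr_ae hIw]
    refine (hφ.integral_norm_sq_realConv_le (Lp.memLp w)).trans ?_
    rw [Lp.integral_norm_sq_eq]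
    gcongr

end Profile

/-! ### Radial approximate identities. -/

section Mollifier

variable {E : Type*} [NormedAddCommGroup E]

/-- A smooth radial bump function, equal to one on the unit ball and supported in the ball of
radius two. -/
noncomputable def radialBump (E : Type*) [NormedAddCommGroup E] (x : E) : ℝ :=
  Real.smoothTransition (2 - ‖x‖ ^ 2)

theorem radialBump_nonneg (x : E) : 0 ≤ radialBump E x := Real.smoothTransition.nonneg _

theorem radialBump_le_one (x : E) : radialBump E x ≤ 1 := Real.smoothTransition.le_one _

theorem radialBump_pos {x : E} (hx : ‖x‖ ≤ 1) : 0 < radialBump E x :=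
  Real.smoothTransition.pos_of_pos (by nlinarith [norm_nonneg x])

theorem support_radialBump_subset :
    Function.support (radialBump E) ⊆ Metric.closedBall 0 2 := by
  intro x hx
  rw [mem_closedBall_zero_iff]
  by_contra! h
  exact hx (Real.smoothTransition.zero_of_nonpos (by nlinarith))

variable [InnerProductSpace ℝ E]

theorem contDiff_radialBump : ContDiff ℝ ∞ (radialBump E) :=
  Real.smoothTransition.contDiff.comp (contDiff_const.sub (contDiff_norm_sq ℝ))

variable [FiniteDimensional ℝ E]

theorem hasCompactSupport_radialBump : HasCompactSupport (radialBump E) :=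
  HasCompactSupport.of_support_subset_isCompact (isCompact_closedBall 0 2)
    support_radialBump_subset

variable [MeasurableSpace E] [BorelSpace E]

theorem integral_radialBump_pos : 0 < ∫ x, radialBump E x := by
  refine (contDiff_radialBump (E := E)).continuous.integral_pos_of_hasCompactSupport_nonneg_nonzero
    hasCompactSupport_radialBump radialBump_nonneg (x := 0) (radialBump_pos (by simp)).ne'

/-- Radial mollifiers concentrating at the origin. -/
noncomputable def radialMollifier (E : Type*) [NormedAddCommGroup E] [InnerProductSpace ℝ E]
    [MeasureSpace E] (k : ℕ) (x : E) : ℝ :=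
  ((k : ℝ) + 1) ^ Module.finrank ℝ E * (∫ y, radialBump E y)⁻¹ *
    radialBump E (((k : ℝ) + 1) • x)

theorem isRadialMollifier_radialMollifier (k : ℕ) : IsRadialMollifier (radialMollifier E k) where
  contDiff := contDiff_const.mul (contDiff_radialBump.comp (contDiff_const_smul _))
  hasCompactSupport := by
    have hk : (k : ℝ) + 1 ≠ 0 := by positivity
    exact (hasCompactSupport_radialBump.comp_smul hk).mul_left
  nonneg x := by
    have := (integral_radialBump_pos (E := E)).le
    have := radialBump_nonneg (((k : ℝ) + 1) • x)
    unfold radialMollifier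
    positivity
  integral_eq_one := by
    have hk : 0 < (k : ℝ) + 1 := by positivity
    have := (integral_radialBump_pos (E := E)).ne'
    simp only [radialMollifier]
    rw [integral_const_mul, Measure.integral_comp_smul, smul_eq_mul, abs_of_pos (by positivity)]
    field_simp
  radial x y hxy := by simp [radialMollifier, radialBump, norm_smul, hxy]

theorem ae_tendsto_realConv_radialMollifier {v : E → ℂ} (hv : LocallyIntegrable v) :
    ∀ᵐ x, Tendsto (fun k => realConv (radialMollifier E k) v x) atTop (𝓝 (v x)) := by
  filter_upwards [(Besicovitch.vitaliFamily (volume : Measure E)).ae_tendsto_average_norm_sub hv]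
    with x hx
  have hrad : Tendsto (fun k : ℕ => 2 / ((k : ℝ) + 1)) atTop (𝓝[>] 0) := by
    refine tendsto_nhdsWithin_iff.2 ⟨?_, Eventually.of_forall fun k => ?_⟩
    · exact tendsto_const_div_atTop_nhds_zero_nat 2 |>.comp (tendsto_add_atTop_nat 1) |>.congr
        fun k => by simp
    · simp only [mem_Ioi]
      positivity
  have h := (hx.comp (Besicovitch.tendsto_filterAt volume x)).comp hrad
  simp_rw [realConv_apply]
  -- Lebesgue differentiation. The constant bounds the kernel's supremum times the volume of the
  -- ball of radius `2 / (k + 1)` containing its support; the powers of `k + 1` cancel.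
  refine tendsto_integral_smul_of_tendsto_average_norm_sub
    ((∫ y, radialBump E y)⁻¹ * 2 ^ Module.finrank ℝ E *
      (volume : Measure E).real (Metric.ball 0 1)) h ?_ ?_ ?_ ?_
  · exact Eventually.of_forall fun k => hv.integrableOn_isCompact (isCompact_closedBall _ _)
  · refine tendsto_const_nhds.congr fun k => ?_
    rw [integral_sub_left_eq_self, (isRadialMollifier_radialMollifier k).integral_eq_one]
  · refine Eventually.of_forall fun k y hy => ?_
    have hk : 0 < (k : ℝ) + 1 := by positivity
    have h1 : ((k : ℝ) + 1) • (x - y) ∈ Function.support (radialBump E) :=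
      right_ne_zero_of_mul hy
    have h2 := support_radialBump_subset h1
    rw [mem_closedBall_zero_iff, norm_smul, Real.norm_of_nonneg hk.le] at h2
    rw [Metric.mem_closedBall, dist_comm, dist_eq_norm, le_div_iff₀' hk]
    exact h2
  · refine Eventually.of_forall fun k y => ?_
    have hk : 0 < (k : ℝ) + 1 := by positivity
    have hI := integral_radialBump_pos (E := E)
    have hb : 0 < (volume : Measure E).real (Metric.ball 0 1) :=
      ENNReal.toReal_pos (Metric.measure_ball_pos _ _ one_pos).ne' measure_ball_lt_top.ne
    rw [abs_of_nonneg ((isRadialMollifier_radialMollifier k).nonneg _),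
      show ((fun r => Metric.closedBall x r) ((fun k : ℕ => 2 / ((k : ℝ) + 1)) k)) =
        Metric.closedBall x (2 / ((k : ℝ) + 1)) from rfl, Measure.addHaar_real_closedBall _ _ (by positivity), radialMollifier]
    calc _ ≤ ((k : ℝ) + 1) ^ Module.finrank ℝ E * (∫ y, radialBump E y)⁻¹ * 1 := by
          gcongr
          exact radialBump_le_one _
      _ = _ := by
          rw [div_pow]
          field_simp

end Mollifier

/-! ### Passage to general functions and the sharp constant. -/

section Inequality

variable {n : ℕ}

/-- Fatou's lemma along the mollifications. Positive upper bounds `A` and `B` replace the norms so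
that the scaling never divides by zero; the powers of `sphereArea n` convert between profile and
`L²` norms. -/
theorem exists_lintegral_le (hn : n ≠ 0) {b q γ : ℝ} (hq : 1 ≤ q)
    (hbq : b ≤ n * (q - 1) / 2) (hγ : 0 < γ) (hγn : ((n : ℝ) - 3) / 2 ≤ γ)
    (hγq : γ * (1 + q) < b + n + 1) :
    ∃ C : ℝ, 0 ≤ C ∧ ∀ (A B : ℝ) (v : H2rd (n + 1)), 0 < A → 0 < B → ‖v.toL2‖ ≤ A →
      ‖v.laplacian‖ ≤ B → ∫⁻ x, ENNReal.ofReal (weightedDensity b q v x) ≤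
        ENNReal.ofReal
          (C * A ^ (1 + q - gnExponent (n + 1) b q) * B ^ gnExponent (n + 1) b q) := by
  obtain ⟨C, hC, H⟩ := RadialProfile.exists_integral_rpow_le hn hq hbq hγ hγn hγq
  have hω := sphereArea_pos n
  have hω2 : 0 < √(sphereArea n) := Real.sqrt_pos.2 hω
  set p := 1 + q - gnExponent (n + 1) b q with hp
  set D := gnExponent (n + 1) b q with hD
  refine ⟨sphereArea n * C / (√(sphereArea n) ^ p * √(sphereArea n) ^ D), by positivity,
    fun A B v hA hB hvA hvB => ?_⟩
  have hvl : LocallyIntegrable v.toL2 := (Lp.memLp v.toL2).locallyIntegrable (by norm_num)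
  set V : ℕ → EuclideanSpace ℝ (Fin (n + 1)) → ℂ := fun k =>
    realConv (radialMollifier _ k) v.toL2 with hV
  have hVc : ∀ k, Continuous (V k) := fun k =>
    continuous_realConv (isRadialMollifier_radialMollifier k).hasCompactSupport
      (isRadialMollifier_radialMollifier k).contDiff.continuous hvl
  have hbound : ∀ k, ∫⁻ x, ENNReal.ofReal (‖x‖ ^ b * ‖V k x‖ ^ (1 + q)) ≤ ENNReal.ofReal
      (sphereArea n * C / (√(sphereArea n) ^ p * √(sphereArea n) ^ D) * A ^ p * B ^ D) := by
    intro k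
    obtain ⟨g, g₁, h, hg, hprof⟩ := exists_radialProfile (isRadialMollifier_radialMollifier k)
      v.radial v.laplacian_spec hvA hvB
    obtain ⟨h1, h2⟩ := H _ _ g g₁ h (by positivity) (by positivity) hprof
    have e : (fun x => ‖x‖ ^ b * ‖V k x‖ ^ (1 + q)) =
        fun x => ‖x‖ ^ b * ‖g ‖x‖‖ ^ (1 + q) := funext fun x => by rw [hV]; simp only [hg]
    rw [← ofReal_integral_eq_lintegral_ofReal]
    · refine ENNReal.ofReal_le_ofReal ?_
      rw [e, integral_comp_norm_eq fun r => r ^ b * ‖g r‖ ^ (1 + q)]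
      calc _ ≤ _ := mul_le_mul_of_nonneg_left h2 hω.le
        _ = _ := by
          rw [Real.div_rpow hA.le hω2.le, Real.div_rpow hB.le hω2.le]
          field_simp
    · rw [e, integrable_comp_norm_iff (f := fun r => r ^ b * ‖g r‖ ^ (1 + q))]
      exact h1
    · exact Eventually.of_forall fun x => by simp only [Pi.zero_apply]; positivity
  have hlim : ∀ᵐ x, ENNReal.ofReal (weightedDensity b q v x) =
      liminf (fun k => ENNReal.ofReal (‖x‖ ^ b * ‖V k x‖ ^ (1 + q))) atTop := by
    filter_upwards [ae_tendsto_realConv_radialMollifier hvl] with x hx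
    refine (Tendsto.liminf_eq ?_).symm
    exact ENNReal.tendsto_ofReal
      ((hx.norm.rpow_const (Or.inr (by linarith))).const_mul (‖x‖ ^ b))
  rw [lintegral_congr_ae hlim]
  refine (lintegral_liminf_le fun k => ?_).trans ?_
  · have := (hVc k).measurable
    fun_prop
  · exact liminf_le_of_le (by isBoundedDefault) fun a ha => by
      obtain ⟨k, hk⟩ := ha.exists
      exact hk.trans (hbound k)

/-- Take `A` and `B` to be the norms plus `ε` and let `ε → 0`. Positivity of both exponents gives
continuity of the right side even where a norm vanishes. -/
theorem integral_weightedDensity_le {N : ℕ} {b q C : ℝ}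
    (hD : 0 < gnExponent N b q) (hDq : 0 < 1 + q - gnExponent N b q)
    (hC : 0 ≤ C) (v : H2rd N)
    (H : ∀ A B : ℝ, 0 < A → 0 < B → ‖v.toL2‖ ≤ A → ‖v.laplacian‖ ≤ B →
      ∫⁻ x, ENNReal.ofReal (weightedDensity b q v x) ≤
        ENNReal.ofReal (C * A ^ (1 + q - gnExponent N b q) * B ^ gnExponent N b q)) :
    Integrable (weightedDensity b q v) ∧ ∫ x, weightedDensity b q v x ≤
      C * ‖v.toL2‖ ^ (1 + q - gnExponent N b q) * ‖v.laplacian‖ ^ gnExponent N b q := by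
  have hnn : ∀ x, 0 ≤ weightedDensity b q v x := fun x => by
    unfold weightedDensity
    positivity
  have hm : AEStronglyMeasurable (weightedDensity b q v) := by
    have h1 : AEMeasurable v.toL2 := (Lp.aestronglyMeasurable v.toL2).aemeasurable
    refine AEMeasurable.aestronglyMeasurable ?_
    unfold weightedDensity
    fun_prop
  have hε : ∀ ε : ℝ, 0 < ε → ∫⁻ x, ENNReal.ofReal (weightedDensity b q v x) ≤
        ENNReal.ofReal (C * (‖v.toL2‖ + ε) ^ (1 + q - gnExponent N b q) *
          (‖v.laplacian‖ + ε) ^ gnExponent N b q) := fun ε hε =>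
    H _ _ (by positivity) (by positivity) (by linarith) (by linarith)
  have hlim : Tendsto (fun ε : ℝ => ENNReal.ofReal
      (C * (‖v.toL2‖ + ε) ^ (1 + q - gnExponent N b q) *
          (‖v.laplacian‖ + ε) ^ gnExponent N b q)) (𝓝[>] 0)
      (𝓝 (ENNReal.ofReal
        (C * ‖v.toL2‖ ^ (1 + q - gnExponent N b q) * ‖v.laplacian‖ ^ gnExponent N b q))) := by
    refine ENNReal.tendsto_ofReal (tendsto_nhdsWithin_of_tendsto_nhds ?_)
    have h1 : ∀ a : ℝ, Tendsto (fun ε : ℝ => a + ε) (𝓝 0) (𝓝 a) := fun a =>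
      Continuous.tendsto' (by fun_prop) _ _ (by simp)
    exact (((h1 _).rpow_const (Or.inr hDq.le)).const_mul C).mul
      ((h1 _).rpow_const (Or.inr hD.le))
  have hle := ge_of_tendsto hlim (eventually_nhdsWithin_of_forall fun ε h => hε ε h)
  refine ⟨⟨hm, ?_⟩, ?_⟩
  · rw [hasFiniteIntegral_iff_ofReal (Eventually.of_forall hnn)]
    exact hle.trans_lt ENNReal.ofReal_lt_top
  · rw [integral_eq_lintegral_of_nonneg_ae (Eventually.of_forall hnn) hm]
    exact ENNReal.toReal_le_of_le_ofReal (by positivity) hle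

/-- A nonzero element of `H²_rd`. -/
theorem exists_integral_weightedDensity_pos {N : ℕ} (hN : N ≠ 0) {b q : ℝ}
    (hint : ∀ v : H2rd N, Integrable (weightedDensity b q v)) :
    ∃ v : H2rd N, 0 < ∫ x, weightedDensity b q v x := by
  have hd : ContDiff ℝ ∞ (fun x : EuclideanSpace ℝ (Fin N) => ((radialBump _ x : ℝ) : ℂ)) :=
    Complex.ofRealCLM.contDiff.comp contDiff_radialBump
  have hcs : HasCompactSupport
      (fun x : EuclideanSpace ℝ (Fin N) => ((radialBump _ x : ℝ) : ℂ)) :=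
    hasCompactSupport_radialBump.comp_left (g := fun r : ℝ => (r : ℂ)) (by simp)
  set ψ : 𝓢(EuclideanSpace ℝ (Fin N), ℂ) := hcs.toSchwartzMap hd with hψ
  have hae : ∀ᵐ x, (ψ.toLp 2 : L2 N) x = ((radialBump _ x : ℝ) : ℂ) := by
    filter_upwards [ψ.coeFn_toLp 2] with x hx
    rw [hx]
    rfl
  let v : H2rd N := ⟨ψ.toLp 2, by
      rw [Lp.toTemperedDistribution_toLp_eq]
      exact ψ.memSobolev, by
      refine ⟨fun r => ((Real.smoothTransition (2 - r ^ 2) : ℝ) : ℂ), ?_⟩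
      filter_upwards [hae] with x hx
      rw [hx]
      rfl⟩
  refine ⟨v, ?_⟩
  have hnn : ∀ x, 0 ≤ weightedDensity b q v x := fun x => by
    unfold weightedDensity
    positivity
  rw [integral_pos_iff_support_of_nonneg hnn (hint v)]
  have : Nonempty (Fin N) := ⟨⟨0, Nat.pos_of_ne_zero hN⟩⟩
  have hball : 0 < volume (Metric.ball (0 : EuclideanSpace ℝ (Fin N)) 1) :=
    Metric.measure_ball_pos _ _ one_pos
  refine hball.trans_le (measure_mono_ae ?_)
  filter_upwards [hae, compl_mem_ae_iff.2 (measure_singleton (μ := volume)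
      (0 : EuclideanSpace ℝ (Fin N)))] with x hx hx0 hxb
  have hx1 : ‖x‖ ≤ 1 := (mem_ball_zero_iff.1 hxb).le
  have hxn : 0 < ‖x‖ := norm_pos_iff.2 hx0
  have : 0 < ‖v.toL2 x‖ := by
    change 0 < ‖(ψ.toLp 2 : L2 N) x‖
    rw [hx, norm_pos_iff]
    exact_mod_cast (radialBump_pos hx1).ne'
  have h2 : 0 < weightedDensity b q v x := by
    unfold weightedDensity
    positivity
  exact h2.ne'

/-- A multiplicative inequality that holds with some constant and is nontrivial has a positive
smallest constant. -/
theorem exists_isLeast_pos {ι : Type*} {I X : ι → ℝ} (hX : ∀ i, 0 ≤ X i) {C : ℝ}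
    (hC : ∀ i, I i ≤ C * X i) (hI : ∃ i, 0 < I i) :
    ∃ K : ℝ, 0 < K ∧ IsLeast {K : ℝ | ∀ i, I i ≤ K * X i} K := by
  obtain ⟨i, hi⟩ := hI
  have hXi : 0 < X i := by
    refine (hX i).lt_of_ne fun h => ?_
    have := hC i
    rw [← h, mul_zero] at this
    linarith
  have hlow : ∀ K ∈ {K : ℝ | ∀ i, I i ≤ K * X i}, I i / X i ≤ K := fun K hK => by
    rw [div_le_iff₀ hXi]
    exact hK i
  have hne : {K : ℝ | ∀ i, I i ≤ K * X i}.Nonempty := ⟨C, hC⟩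
  refine ⟨sInf {K : ℝ | ∀ i, I i ≤ K * X i}, ?_, ?_, fun K hK => csInf_le ⟨_, hlow⟩ hK⟩
  · exact (div_pos hi hXi).trans_le (le_csInf hne hlow)
  · intro j
    rcases (hX j).eq_or_lt with h | h
    -- When `X j = 0` the constant is irrelevant, and the known `C` already forces `I j ≤ 0`.
    · have := hC j
      rwa [← h, mul_zero] at this ⊢
    · rw [← div_le_iff₀ h]
      refine le_csInf hne fun K hK => ?_
      rw [div_le_iff₀ h]
      exact hK j

end Inequality

theorem proposition1p7 (N : ℕ) (hN : 2 ≤ N) (b q : ℝ) (hb : 0 < b)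
    (hq : 1 + 2 * b / ((N : ℝ) - 1) < q) (hqe : (q : EReal) < energyCriticalExponent N b) :
    (∀ v : H2rd N, Integrable (weightedDensity b q v)) ∧
    ∃ C : ℝ, 0 < C ∧
      IsLeast {K : ℝ | ∀ v : H2rd N,
        ∫ x, weightedDensity b q v x ≤
          K * ‖v.toL2‖ ^ (1 + q - gnExponent N b q) * ‖v.laplacian‖ ^ gnExponent N b q} C := by
  obtain ⟨n, rfl⟩ : ∃ n, N = n + 1 := ⟨N - 1, by omega⟩
  have hn1 : (1 : ℝ) ≤ n := by exact_mod_cast (by omega : 1 ≤ n)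
  push_cast at hq
  rw [add_sub_cancel_right] at hq
  have hnb : 2 * b < (q - 1) * n := by
    rw [← div_lt_iff₀ (by linarith)]
    linarith
  have hq1 : 1 < q := by
    have : 0 < 2 * b / n := by positivity
    linarith
  have hD : 0 < gnExponent (n + 1) b q := by
    unfold gnExponent
    push_cast
    nlinarith
  -- Subcriticality without division: it is `q < q^e` for `n > 3` and automatic for `n ≤ 3`. It is
  -- equivalent to `1 + q - D > 0`, and leaves room for the choice of `γ`.
  have hcrit : ((n : ℝ) - 3) * (1 + q) < 2 * (b + n + 1) := by
    rcases le_or_gt n 3 with h3 | h3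
    · have : (n : ℝ) ≤ 3 := by exact_mod_cast h3
      nlinarith
    · have h3' : (3 : ℝ) < n := by exact_mod_cast h3
      rw [energyCriticalExponent, if_pos (by omega), EReal.coe_lt_coe_iff] at hqe
      push_cast at hqe
      have h4 : q - 1 < (8 + 2 * b) / ((n : ℝ) + 1 - 4) := by linarith
      rw [lt_div_iff₀ (by linarith)] at h4
      nlinarith
  have hDq : 0 < 1 + q - gnExponent (n + 1) b q := by
    unfold gnExponent
    push_cast
    nlinarith
  obtain ⟨γ, hγ, hγn, hγq⟩ : ∃ γ : ℝ, 0 < γ ∧ ((n : ℝ) - 3) / 2 ≤ γ ∧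
      γ * (1 + q) < b + n + 1 := by
    obtain ⟨γ, h1, h2⟩ := exists_between
      (show max 0 (((n : ℝ) - 3) / 2) < (b + n + 1) / (1 + q) by
        rw [max_lt_iff]
        constructor
        · positivity
        · rw [lt_div_iff₀ (by linarith)]
          linarith)
    rw [max_lt_iff] at h1
    exact ⟨γ, h1.1, h1.2.le, (lt_div_iff₀ (by linarith)).1 h2⟩
  obtain ⟨C, hC, H⟩ := exists_lintegral_le (n := n) (by omega) hq1.le (by linarith) hγ hγn hγq
  have main := fun v : H2rd (n + 1) =>
    integral_weightedDensity_le hD hDq hC v fun A B => H A B v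
  refine ⟨fun v => (main v).1, ?_⟩
  simp_rw [mul_assoc]
  exact exists_isLeast_pos (C := C) (fun v => by positivity)
    (fun v => by rw [← mul_assoc]; exact (main v).2)
    (exists_integral_weightedDensity_pos (by omega) fun v => (main v).1)
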